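/- Let $n$ traders $1,\dots,n$ each own one good, trader $k$ owning good $k$, and let trader $k$ rank all $n$ goods by a permutation $p_k=p_{k1}p_{k2}\ldots p_{kn}$ of $\{1,\dots,n\}$, most preferred good first; the rank of $p_{kj}$ for trader $k$ is $j$. An allocation is a permutation $g_1\ldots g_n$ of $\{1,\dots,n\}$ (trader $k$ gets good $g_k$). It is *stable* if for every nonempty set $C$ of traders and every permutation $h$ of $C$: if for all $k\in C$ the rank of $h_k$ in $p_k$ is at most that of $g_k$, then $h_k=g_k$ for all $k\in C$. For every choice of $p_1,\dots,p_n$ there is exactly one stable allocation $g$; let $r_k$ be the rank of $g_k$ for trader $k$, i.e. $g_k=p_{kr_k}$. Suppose that $p_1,\dots,p_n$ are independent uniformly random permutations of $\{1,\dots,n\}$. Then for all real $z$ (equivalently, as polynomials in $z$): $$\mathrm E\bigl[(z+r_1)\cdots(z+r_n)\bigr]=\frac1{(n+1)!}\prod_{k=2}^{n+1}(kz+n+1),$$ $$(z+n+1)\,\mathrm E\bigl[(z+r_1)\cdots(z+r_n)\bigr]=\sum_{k=0}^{n+1}{n+2\brack k+1}\frac{(n+1)^k}{(n+1)!}\,z^{n+1-k},$$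 where ${m\brack k}$ is the Stirling cycle number (the number of permutations of $m$ elements with exactly $k$ cycles), so that for $0\le j\le n$ the coefficient of $z^{n-j}$ in $\mathrm E[(z+r_1)\cdots(z+r_n)]$ is $$\sum_{i=0}^{j}\bigl(-(n+1)\bigr)^{j-i}{n+2\brack i+1}\frac{(n+1)^i}{(n+1)!};$$ and $$\mathrm E\bigl[(z+r_1^2)\cdots(z+r_n^2)\bigr]=\prod_{k=1}^n\left(z+\frac{(n+1)(n+1+k)}{(n+2-k)(n+3-k)}\right).$$ -/

import Mathlib

namespace StableAllocation

open MeasureTheory ProbabilityTheory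

/-- Every set of rankings of `n` goods is an event. -/
instance permMeasurableSpace (n : ℕ) : MeasurableSpace (Equiv.Perm (Fin n)) := ⊤

/-- Preference lists of `n` traders: `p k j` is the good that trader `k` puts in position `j`
of the list (positions counted from `0`). Good `i` is the one initially owned by trader `i`. -/
abbrev Preferences (n : ℕ) := Fin n → Equiv.Perm (Fin n)

/-- The rank (counted from `1`) of good `i` in the list of trader `k`; a smaller rank means
a more preferred good. -/
def rank {n : ℕ} (p : Preferences n) (k i : Fin n) : ℕ := ((p k).symm i : ℕ) + 1

/-- The allocation `g` is stable: if a coalition `C` can redistribute its own goods among its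
members by `h` so that every member likes the new good at least as much as the one given by `g`,
then every member of `C` receives from `h` exactly the good given by `g`. -/
def IsStable {n : ℕ} (p : Preferences n) (g : Equiv.Perm (Fin n)) : Prop :=
  ∀ C : Finset (Fin n), C.Nonempty → ∀ h : Equiv.Perm C,
    (∀ k : C, rank p k (h k) ≤ rank p k (g k)) → ∀ k : C, (h k : Fin n) = g k

/-- The stable allocation (there is exactly one, which is part of the theorem). -/
noncomputable def stableAllocation {n : ℕ} (p : Preferences n) : Equiv.Perm (Fin n) :=
  Classical.epsilon (IsStable p)

/-- `r_k`: the rank, in the list of trader `k`, of the good that this trader gets in the stable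
allocation. -/
noncomputable def stableRank {n : ℕ} (p : Preferences n) (k : Fin n) : ℕ :=
  rank p k (stableAllocation p k)

/-- The preference lists `P ω 0, …, P ω (n - 1)` are independent random permutations, each of them
uniformly distributed. -/
structure IsUniformRandom {Ω : Type*} [MeasurableSpace Ω] (μ : Measure Ω) {n : ℕ}
    (P : Ω → Preferences n) : Prop where
  measurable : ∀ k, Measurable fun ω => P ω k
  indep : iIndepFun (fun k ω => P ω k) μ
  uniform : ∀ k, μ.map (fun ω => P ω k) = uniformOn Set.univ

end StableAllocation

open MeasureTheory StableAllocation

/-! ### Uniqueness of the stable allocation -/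

namespace StableAllocation

variable {n : ℕ}

/-! The weighted sum over all pairs (preferences, stable allocation) is computed by double counting.
For fixed `g`, relabelling the goods by `g` turns "`g` is stable" into "the envy relation becomes
acyclic when the cycles of `g` are contracted", while the rank of the good received by `k` becomes
the rank of good `k` in the relabelled list (`isStable_mul_iff`).

For a fixed relation, the permutations with this property are equinumerous with its linear
extensions: both counts satisfy the recurrence that deletes one sink `v` (`card_gradedPerms`). That
`v` is a sink of `U` concerns only the list of `v`: it says that `v` precedes the rest of `U` there.
Hence the sum over independent lists factors (`sum_card_gradedPerms_mul_prod`), a set of size `m`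
contributing `m` choices of `v` times a one-list sum `G m`.

The sums `G m` follow from symmetry among the elements of `U` for every weight quadratic in the rank
(`sum_first_quadratic`), which covers both `z + r` and `z + r ^ 2`. With weight 1 the total is `n! ^
n`, the number of preference systems; together with uniqueness this gives existence, with no
algorithm for finding the allocation. -/

theorem rank_injective (p : Preferences n) (k : Fin n) : Function.Injective (rank p k) := by
  intro i j h
  simpa [rank, Fin.val_inj] using h

/-- If everybody weakly prefers `m k` to `g k`, then a stable `g` agrees with `m` on the
recurrent part of `m`. -/
theorem IsStable.eq_on_periodicPts {p : Preferences n} {g : Equiv.Perm (Fin n)}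
    (hg : IsStable p g) {m : Fin n → Fin n} (hm : ∀ k, rank p k (m k) ≤ rank p k (g k))
    {k : Fin n} (hk : k ∈ Function.periodicPts m) : m k = g k := by
  classical
  -- Any map permutes its periodic points, so the recurrent traders form a coalition that can trade
  -- along `m`.
  let C : Finset (Fin n) := Finset.univ.filter (· ∈ Function.periodicPts m)
  have hC : ∀ x, x ∈ C ↔ x ∈ Function.periodicPts m := by simp [C]
  have hb := Function.bijOn_periodicPts m
  let h : C → C := fun x => ⟨m x, (hC _).2 (hb.mapsTo ((hC _).1 x.2))⟩
  have hinj : Function.Injective h := by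
    intro x y hxy
    apply Subtype.ext
    exact hb.injOn ((hC _).1 x.2) ((hC _).1 y.2) (congrArg Subtype.val hxy)
  have := hg C ⟨k, (hC k).2 hk⟩ (Equiv.ofBijective h (Finite.injective_iff_bijective.1 hinj))
    (fun x => hm x) ⟨k, (hC k).2 hk⟩
  simpa [h] using this

/-- Let `m` choose the better of the two goods. On its cycles `m` agrees with both allocations;
injectivity of these then keeps a non-recurrent trader from ever entering a cycle, which is
impossible in a finite set. So all traders are recurrent. -/
theorem IsStable.unique {p : Preferences n} {g g' : Equiv.Perm (Fin n)}
    (hg : IsStable p g) (hg' : IsStable p g') : g = g' := by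
  classical
  let m : Fin n → Fin n := fun k => if rank p k (g k) ≤ rank p k (g' k) then g k else g' k
  have h1 : ∀ k, rank p k (m k) ≤ rank p k (g k) := by
    intro k; simp only [m]; split_ifs <;> omega
  have h2 : ∀ k, rank p k (m k) ≤ rank p k (g' k) := by
    intro k; simp only [m]; split_ifs <;> omega
  have e1 : ∀ k ∈ Function.periodicPts m, m k = g k := fun k hk => hg.eq_on_periodicPts h1 hk
  have e2 : ∀ k ∈ Function.periodicPts m, m k = g' k := fun k hk => hg'.eq_on_periodicPts h2 hk
  have hb := Function.bijOn_periodicPts m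
  have key : ∀ k, k ∉ Function.periodicPts m → m k ∉ Function.periodicPts m := by
    intro k hk hmk
    obtain ⟨y, hy, hym⟩ := hb.surjOn hmk
    have hcase : m k = g k ∨ m k = g' k := by
      simp only [m]; split_ifs <;> simp
    rcases hcase with h | h
    · rw [h, e1 y hy] at hym
      exact hk (g.injective hym ▸ hy)
    · rw [h, e2 y hy] at hym
      exact hk (g'.injective hym ▸ hy)
  have hall : ∀ k, k ∈ Function.periodicPts m := by
    intro k
    by_contra hk
    have hit : ∀ j, m^[j] k ∉ Function.periodicPts m := by
      intro j
      induction j with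
      | zero => exact hk
      | succ j ih => rw [Function.iterate_succ_apply']; exact key _ ih
    obtain ⟨a, b, hab, heq⟩ := Finite.exists_ne_map_eq_of_infinite (fun j : ℕ => m^[j] k)
    wlog hlt : a < b generalizing a b
    · exact this b a hab.symm heq.symm (by omega)
    apply hit a
    refine ⟨b - a, by omega, ?_⟩
    change m^[b - a] (m^[a] k) = m^[a] k
    rw [← Function.iterate_add_apply, Nat.sub_add_cancel hlt.le]
    exact heq.symm
  ext k
  rw [← e1 k (hall k), ← e2 k (hall k)]

/-! ### Stability as acyclicity after contracting cycles -/

theorem iterate_update_apply {α : Type*} [DecidableEq α] (F : α → α) (x z y : α) (j : ℕ)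
    (h : ∀ i < j, F^[i] y ≠ x) : (Function.update F x z)^[j] y = F^[j] y := by
  induction j with
  | zero => rfl
  | succ j ih =>
    rw [Function.iterate_succ_apply', Function.iterate_succ_apply',
      ih (fun i hi => h i (by omega)), Function.update_of_ne (h j (by omega))]

/-- Along a relation with at least one arrow out of every point, a walk from `x` to `k` can be
followed by iterating a function that selects arrows. -/
theorem exists_selection_of_reflTransGen {α : Type*} [DecidableEq α] {R : α → α → Prop}
    (g : α → α) (hg : ∀ x, R x (g x)) {x k : α} (h : Relation.ReflTransGen R x k) :
    ∃ F : α → α, (∀ y, R y (F y)) ∧ ∃ j, F^[j] x = k := by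
  induction h using Relation.ReflTransGen.head_induction_on with
  | refl => exact ⟨g, hg, 0, rfl⟩
  | @head x y hxy _ ih =>
    obtain ⟨F, hF, j, hj⟩ := ih
    -- If `F` does not already lead from `x` to `k`, the path from `y` to `k` avoids `x`, so
    -- redirecting `x` to `y` leaves that path intact.
    by_cases hx : ∃ i, F^[i] x = k
    · exact ⟨F, hF, hx⟩
    · refine ⟨Function.update F x y, fun w => ?_, j + 1, ?_⟩
      · by_cases hw : w = x
        · subst hw; simpa using hxy
        · simpa [hw] using hF w
      · rw [Function.iterate_succ_apply, Function.update_self, iterate_update_apply, hj]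
        intro i hi hix
        apply hx
        refine ⟨j - i, ?_⟩
        rw [← hix, ← Function.iterate_add_apply, Nat.sub_add_cancel hi.le, hj]

/-- Redirecting `k` to `x` closes the path. Taking the least number of steps from `x` to `k` ensures
that the path does not meet `k` earlier, where the redirection would alter it. -/
theorem exists_selection_of_cycle {α : Type*} [DecidableEq α] {R : α → α → Prop}
    (g : α → α) (hg : ∀ x, R x (g x)) {x k : α} (h : Relation.ReflTransGen R x k)
    (hkx : R k x) : ∃ F : α → α, (∀ y, R y (F y)) ∧ F k = x ∧ k ∈ Function.periodicPts F := by
  obtain ⟨F, hF, hj⟩ := exists_selection_of_reflTransGen g hg h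
  refine ⟨Function.update F k x, fun w => ?_, by simp, Nat.find hj + 1, by omega, ?_⟩
  · by_cases hw : w = k
    · subst hw; simpa using hkx
    · simpa [hw] using hF w
  · change (Function.update F k x)^[_] k = k
    rw [Function.iterate_succ_apply, Function.update_self, iterate_update_apply]
    · exact Nat.find_spec hj
    · exact fun i hi => Nat.find_min hj hi

/-- The relation `D` becomes acyclic when the cycles of `g` are contracted, on the set `U`. -/
def IsGraded {α : Type*} (D : α → α → Prop) (U : Finset α) (g : Equiv.Perm α) : Prop :=
  ∃ ht : α → ℕ, (∀ x, ht (g x) = ht x) ∧ ∀ k ∈ U, ∀ i ∈ U, D k i → ht i < ht k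

/-- Trader `k` strictly prefers good `i` to good `k`. -/
def Envies (p : Preferences n) (k i : Fin n) : Prop := (p k).symm i < (p k).symm k

theorem rank_mul (p : Preferences n) (g : Equiv.Perm (Fin n)) (k i : Fin n) :
    rank (fun k => g * p k) k i = rank p k (g.symm i) := by
  simp [rank, Equiv.Perm.mul_def]

/-- In the list `g * p k`, good `g i` occupies the place that `i` has in `p k`; thus `g k` has the
rank of `k`, and strictly preferring `g i` to `g k` means envying `i`. -/
theorem isStable_mul_iff (p : Preferences n) (g : Equiv.Perm (Fin n)) :
    IsStable (fun k => g * p k) g ↔ IsGraded (Envies p) Finset.univ g := by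
  classical
  constructor
  · intro hg
    -- `R k j`: in the relabelled list, trader `k` likes good `j` at least as much as `g k`. The
    -- height of `k` will be the number of traders reachable from `k`; it is constant on cycles of
    -- `g` because `g` itself follows arrows.
    let R : Fin n → Fin n → Prop := fun k j => rank p k (g.symm j) ≤ rank p k k
    have hR : ∀ k, R k (g k) := fun k => by simp [R]
    let reach : Fin n → Finset (Fin n) := fun k =>
      Finset.univ.filter fun j => Relation.ReflTransGen R k j
    have hmono : ∀ {k j}, Relation.ReflTransGen R k j → reach j ⊆ reach k := by
      intro k j hkj x hx
      simp only [reach, Finset.mem_filter, Finset.mem_univ, true_and] at hx ⊢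
      exact hkj.trans hx
    have hback : ∀ k, Relation.ReflTransGen R (g k) k := by
      intro k
      have hit : ∀ j : ℕ, Relation.ReflTransGen R (g k) ((g ^ j) (g k)) := by
        intro j
        induction j with
        | zero => exact .refl
        | succ j ih =>
          refine ih.tail ?_
          rw [pow_succ']
          exact hR _
      have h1 := hit (orderOf g - 1)
      rwa [← Equiv.Perm.mul_apply, ← pow_succ, Nat.sub_add_cancel (orderOf_pos g),
        pow_orderOf_eq_one] at h1
    have hreach : ∀ k, reach (g k) = reach k := fun k =>
      (hmono (.single (hR k))).antisymm (hmono (hback k))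
    refine ⟨fun k => (reach k).card, fun k => congrArg Finset.card (hreach k), fun k _ i _ hD => ?_⟩
    have hki : R k (g i) := by
      simp only [R, Equiv.symm_apply_apply, rank]
      have : ((p k).symm i : ℕ) < (p k).symm k := hD
      omega
    change (reach i).card < (reach k).card
    rw [← hreach i]
    apply Finset.card_lt_card
    refine ⟨hmono (.single hki), fun hsub => ?_⟩
    -- If the height did not drop, the strict arrow from `k` to `g i` would lie on a closed walk,
    -- hence on a cycle of some selection, and stability would force `g i = g k`.
    have hk : k ∈ reach (g i) := hsub (by simp [reach, Relation.ReflTransGen.refl])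
    obtain ⟨F, hF, hFk, hper⟩ := exists_selection_of_cycle g hR
      (by simpa [reach] using hk) hki
    have := hg.eq_on_periodicPts (m := F)
      (fun x => by rw [rank_mul, rank_mul, Equiv.symm_apply_apply]; exact hF x) hper
    rw [hFk] at this
    rw [g.injective this] at hD
    exact lt_irrefl _ hD
  · rintro ⟨ht, hinv, hD⟩ C - h hh k
    have hcase : ∀ k : C, (h k : Fin n) = g k ∨ ht (h k) < ht k := by
      intro k
      have := hh k
      rw [rank_mul, rank_mul, Equiv.symm_apply_apply] at this
      rcases this.lt_or_eq with h1 | h1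
      · right
        have h2 := hD k (Finset.mem_univ _) (g.symm (h k)) (Finset.mem_univ _) (by
          simp only [rank] at h1
          change ((p k).symm _ : ℕ) < (p k).symm k
          omega)
        rwa [← hinv, Equiv.apply_symm_apply] at h2
      · left
        have := rank_injective p k h1
        rw [← this, Equiv.apply_symm_apply]
    -- A permutation of `C` preserves the total height, so no individual height can drop.
    have hsum : ∑ k : C, ht (h k) = ∑ k : C, ht k :=
      Equiv.sum_comp h fun k : C => ht k
    have hle : ∀ k ∈ (Finset.univ : Finset C), ht (h k) ≤ ht k := by
      intro k _
      rcases hcase k with h1 | h1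
      · rw [h1, hinv]
      · exact h1.le
    have heq := (Finset.sum_eq_sum_iff_of_le hle).1 hsum k (Finset.mem_univ _)
    rcases hcase k with h1 | h1
    · exact h1
    · omega

end StableAllocation

/-! ### Counting permutations with acyclic quotient -/

namespace StableAllocation

section Counting

open Classical in
/-- The union of the cycles of `e` that lie in `S`. -/
noncomputable def cyclesInside {α : Type*} [Fintype α] (S : Finset α) (e : Equiv.Perm α) :
    Finset α :=
  Finset.univ.filter fun k => ∃ W : Finset α, (∀ x ∈ W, e x ∈ W) ∧ W ⊆ S ∧ k ∈ W

open Classical in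
/-- The elements of `U` from which no arrow of `D` leads to `U`. -/
noncomputable def sinks {α : Type*} (D : α → α → Prop) (U : Finset α) : Finset α :=
  U.filter fun v => ∀ i ∈ U, ¬ D v i

open Classical in
/-- The permutations of `U` such that `D` becomes acyclic when their cycles are contracted. -/
noncomputable def gradedPerms {α : Type*} [Fintype α] (D : α → α → Prop) (U : Finset α) :
    Finset (Equiv.Perm α) :=
  Finset.univ.filter fun e => (∀ x ∉ U, e x = x) ∧ IsGraded D U e

variable {α : Type*} {S U W : Finset α} {e : Equiv.Perm α} {D : α → α → Prop}

theorem apply_mem_iff_of_forall_apply_mem (hW : ∀ x ∈ W, e x ∈ W) (x : α) : e x ∈ W ↔ x ∈ W := by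
  classical
  refine ⟨fun hx => ?_, hW x⟩
  have himg : W.image e = W := Finset.eq_of_subset_of_card_le
    (Finset.image_subset_iff.2 hW) (Finset.card_image_of_injective W e.injective).ge
  rw [← himg, Finset.mem_image] at hx
  obtain ⟨y, hy, hyx⟩ := hx
  exact e.injective hyx ▸ hy

theorem apply_swap_of_eq {β : Type*} [DecidableEq α] (f : α → β) {a b : α} (h : f a = f b)
    (x : α) : f (Equiv.swap a b x) = f x := by
  rw [Equiv.swap_apply_def]
  split_ifs with h1 h2
  · rw [h1, h]
  · rw [h2, h]
  · rfl

theorem apply_mem_of_fixed_outside (h : ∀ x ∉ U, e x = x) {x : α} (hx : x ∈ U) : e x ∈ U := by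
  by_contra hn
  exact hn ((e.injective (h _ hn)).symm ▸ hx)

theorem mem_sinks {v : α} : v ∈ sinks D U ↔ v ∈ U ∧ ∀ i ∈ U, ¬ D v i := by
  simp [sinks]

variable [Fintype α]

theorem mem_cyclesInside {k : α} : k ∈ cyclesInside S e ↔
    ∃ W : Finset α, (∀ x ∈ W, e x ∈ W) ∧ W ⊆ S ∧ k ∈ W := by
  simp [cyclesInside]

theorem cyclesInside_subset : cyclesInside S e ⊆ S := by
  intro k hk
  obtain ⟨W, -, hWS, hkW⟩ := mem_cyclesInside.1 hk
  exact hWS hkW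

theorem apply_mem_cyclesInside {k : α} (hk : k ∈ cyclesInside S e) : e k ∈ cyclesInside S e := by
  obtain ⟨W, hW, hWS, hkW⟩ := mem_cyclesInside.1 hk
  exact mem_cyclesInside.2 ⟨W, hW, hWS, hW k hkW⟩

theorem subset_cyclesInside (hW : ∀ x ∈ W, e x ∈ W) (hWS : W ⊆ S) : W ⊆ cyclesInside S e :=
  fun _ hk => mem_cyclesInside.2 ⟨W, hW, hWS, hk⟩

theorem apply_mem_cyclesInside_iff (x : α) : e x ∈ cyclesInside S e ↔ x ∈ cyclesInside S e :=
  apply_mem_iff_of_forall_apply_mem (fun _ => apply_mem_cyclesInside) x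

theorem mem_gradedPerms : e ∈ gradedPerms D U ↔ (∀ x ∉ U, e x = x) ∧ IsGraded D U e := by
  simp [gradedPerms]

/-- The elements of least height in `U` are sinks and form a union of cycles. -/
theorem cyclesInside_sinks_nonempty (he : e ∈ gradedPerms D U) (hU : U.Nonempty) :
    (cyclesInside (sinks D U) e).Nonempty := by
  classical
  obtain ⟨hfix, ht, hinv, hD⟩ := mem_gradedPerms.1 he
  obtain ⟨k, hkU, hk⟩ := U.exists_min_image ht hU
  refine ⟨k, mem_cyclesInside.2 ⟨U.filter fun x => ht x = ht k, ?_, ?_, by simp [hkU]⟩⟩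
  · intro x hx
    rw [Finset.mem_filter] at hx ⊢
    exact ⟨apply_mem_of_fixed_outside hfix hx.1, by rw [hinv, hx.2]⟩
  · intro x hx
    rw [Finset.mem_filter] at hx
    refine mem_sinks.2 ⟨hx.1, fun i hi hxi => ?_⟩
    have := hD x hx.1 i hi hxi
    have := hk i hi
    omega

theorem gradedPerms_empty (D : α → α → Prop) : gradedPerms D (∅ : Finset α) = {1} := by
  ext e
  rw [mem_gradedPerms, Finset.mem_singleton]
  refine ⟨fun h => Equiv.ext fun x => h.1 x (Finset.notMem_empty x), ?_⟩
  rintro rfl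
  exact ⟨fun _ _ => rfl, fun _ => 0, fun _ => rfl, fun k hk => absurd hk (Finset.notMem_empty k)⟩

variable [DecidableEq α]

/-- Multiplying by the transposition cuts `v` out of its cycle and makes it a fixed point, leaving
the other cycles untouched. -/
theorem cyclesInside_erase {v : α} (hv : v ∈ cyclesInside S e) :
    cyclesInside (S.erase v) (Equiv.swap v (e v) * e) = (cyclesInside S e).erase v := by
  set e' := Equiv.swap v (e v) * e with he'
  have hT : ∀ x, e' x ∈ cyclesInside S e ↔ x ∈ cyclesInside S e := by
    intro x
    rw [he', Equiv.Perm.mul_apply, ← apply_mem_cyclesInside_iff (e := e) x]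
    exact iff_of_eq (apply_swap_of_eq (· ∈ cyclesInside S e)
      (propext (apply_mem_cyclesInside_iff v).symm) (e x))
  have hv' : e' v = v := by simp [he']
  apply Finset.Subset.antisymm
  · intro x hx
    have hxS := Finset.mem_erase.1 (cyclesInside_subset hx)
    refine Finset.mem_erase.2 ⟨hxS.1, ?_⟩
    -- Outside `cyclesInside S e` the two permutations agree, so this union is closed under `e`.
    refine subset_cyclesInside (W := cyclesInside S e ∪ cyclesInside (S.erase v) e') ?_ ?_
      (Finset.mem_union_right _ hx)
    · intro y hy
      by_cases hyT : y ∈ cyclesInside S e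
      · exact Finset.mem_union_left _ (apply_mem_cyclesInside hyT)
      · have hy' := (Finset.mem_union.1 hy).resolve_left hyT
        have h1 : e y ≠ v := fun h => hyT ((apply_mem_cyclesInside_iff y).1 (h ▸ hv))
        have h2 : e y ≠ e v := fun h => hyT (e.injective h ▸ hv)
        have h3 : e' y = e y := by
          rw [he', Equiv.Perm.mul_apply, Equiv.swap_apply_of_ne_of_ne h1 h2]
        exact Finset.mem_union_right _ (h3 ▸ apply_mem_cyclesInside hy')
    · exact Finset.union_subset cyclesInside_subset
        (cyclesInside_subset.trans (Finset.erase_subset _ _))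
  · apply subset_cyclesInside
    · intro x hx
      rw [Finset.mem_erase] at hx ⊢
      exact ⟨fun h => hx.1 (e'.injective (h.trans hv'.symm)), (hT x).2 hx.2⟩
    · exact Finset.erase_subset_erase v cyclesInside_subset

/-- Used for the inverse operation: the fixed point `v` is inserted just before `w`, or left fixed
when `w = v`. -/
theorem insert_cyclesInside_invariant {v w : α} (hev : e v = v)
    (hw : w ∈ insert v (cyclesInside (S.erase v) e)) (x : α) :
    (Equiv.swap v w * e) x ∈ insert v (cyclesInside (S.erase v) e) ↔
      x ∈ insert v (cyclesInside (S.erase v) e) := by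
  have h := apply_swap_of_eq (· ∈ insert v (cyclesInside (S.erase v) e))
      (a := v) (b := w) (by simp only [hw, Finset.mem_insert_self]) (e x)
  rw [Equiv.Perm.mul_apply, iff_of_eq h, Finset.mem_insert, Finset.mem_insert,
    apply_mem_cyclesInside_iff]
  refine or_congr ⟨fun h => e.injective (h.trans hev.symm), fun h => h ▸ hev⟩ Iff.rfl

theorem mem_cyclesInside_swap_mul {v w : α} (hev : e v = v) (hv : v ∈ S)
    (hw : w ∈ insert v (cyclesInside (S.erase v) e)) :
    v ∈ cyclesInside S (Equiv.swap v w * e) := by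
  refine subset_cyclesInside (W := insert v (cyclesInside (S.erase v) e))
    (fun x hx => (insert_cyclesInside_invariant hev hw x).2 hx) ?_ (Finset.mem_insert_self _ _)
  exact Finset.insert_subset hv (cyclesInside_subset.trans (Finset.erase_subset _ _))

theorem swap_mul_mem_gradedPerms_erase {v : α} (he : e ∈ gradedPerms D U) (hv : v ∈ U) :
    Equiv.swap v (e v) * e ∈ gradedPerms D (U.erase v) := by
  obtain ⟨hfix, ht, hinv, hD⟩ := mem_gradedPerms.1 he
  refine mem_gradedPerms.2 ⟨fun x hx => ?_, ht, fun x => ?_, fun k hk i hi =>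
    hD k (Finset.mem_of_mem_erase hk) i (Finset.mem_of_mem_erase hi)⟩
  · by_cases hxv : x = v
    · subst hxv; simp
    · have hxU : x ∉ U := fun h => hx (Finset.mem_erase.2 ⟨hxv, h⟩)
      rw [Equiv.Perm.mul_apply, hfix x hxU, Equiv.swap_apply_of_ne_of_ne hxv]
      exact fun h => hxU (h ▸ apply_mem_of_fixed_outside hfix hv)
  · rw [Equiv.Perm.mul_apply, apply_swap_of_eq ht (hinv v).symm, hinv]

theorem swap_mul_mem_gradedPerms {v w : α} (he : e ∈ gradedPerms D (U.erase v))
    (hv : v ∈ sinks D U) (hw : w ∈ insert v (cyclesInside ((sinks D U).erase v) e)) :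
    Equiv.swap v w * e ∈ gradedPerms D U := by
  obtain ⟨hfix, ht, hinv, hD⟩ := mem_gradedPerms.1 he
  have hev : e v = v := hfix v (by simp)
  have hsub : insert v (cyclesInside ((sinks D U).erase v) e) ⊆ sinks D U :=
    Finset.insert_subset hv (cyclesInside_subset.trans (Finset.erase_subset _ _))
  have hinv' := insert_cyclesInside_invariant hev hw
  -- The cycles on which the insertion takes place consist of sinks, so they can all be put at
  -- height 0 below everything else, raised by one.
  refine mem_gradedPerms.2 ⟨fun x hx => ?_,
    fun x => if x ∈ insert v (cyclesInside ((sinks D U).erase v) e) then 0 else ht x + 1,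
    fun x => ?_, fun k hk i hi hki => ?_⟩
  · rw [Equiv.Perm.mul_apply, hfix x (fun h => hx (Finset.mem_of_mem_erase h)),
      Equiv.swap_apply_of_ne_of_ne]
    · exact fun h => hx (h ▸ (mem_sinks.1 hv).1)
    · exact fun h => hx (h ▸ (mem_sinks.1 (hsub hw)).1)
  · simp only [hinv' x]
    split_ifs with hx
    · rfl
    · have h1 : e x ≠ v := fun h => hx (by
        rw [e.injective (h.trans hev.symm)]; exact Finset.mem_insert_self _ _)
      have h2 : e x ≠ w := fun h => hx ((hinv' x).1 (by
        rw [Equiv.Perm.mul_apply, h, Equiv.swap_apply_right]; exact Finset.mem_insert_self _ _))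
      rw [Equiv.Perm.mul_apply, Equiv.swap_apply_of_ne_of_ne h1 h2, hinv]
  · have hk' : k ∉ insert v (cyclesInside ((sinks D U).erase v) e) := fun h =>
      (mem_sinks.1 (hsub h)).2 i hi hki
    simp only [if_neg hk']
    split_ifs with hi'
    · omega
    · have hkv : k ≠ v := fun h => hk' (h ▸ Finset.mem_insert_self _ _)
      have hiv : i ≠ v := fun h => hi' (h ▸ Finset.mem_insert_self _ _)
      have := hD k (Finset.mem_erase.2 ⟨hkv, hk⟩) i (Finset.mem_erase.2 ⟨hiv, hi⟩) hki
      omega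

/-- Permutations with acyclic quotient satisfy the recurrence of linear extensions. -/
theorem card_gradedPerms (D : α → α → Prop) {U : Finset α} (hU : U.Nonempty) :
    ((gradedPerms D U).card : ℝ) =
      ∑ v ∈ sinks D U, ((gradedPerms D (U.erase v)).card : ℝ) := by
  -- Each permutation spreads unit weight evenly over the elements of its cycles made of sinks.
  calc ((gradedPerms D U).card : ℝ)
      = ∑ e ∈ gradedPerms D U, ∑ v ∈ cyclesInside (sinks D U) e,
          (1 / ((cyclesInside (sinks D U) e).card : ℝ)) := by
        rw [Finset.cast_card]
        refine Finset.sum_congr rfl fun e he => ?_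
        have := (cyclesInside_sinks_nonempty he hU).card_pos
        rw [Finset.sum_const, nsmul_eq_mul, mul_one_div_cancel (by positivity)]
    _ = ∑ v ∈ sinks D U, ∑ e ∈ (gradedPerms D U).filter
          (fun e => v ∈ cyclesInside (sinks D U) e),
          (1 / ((cyclesInside (sinks D U) e).card : ℝ)) := by
        apply Finset.sum_comm'
        intro e v
        rw [Finset.mem_filter]
        exact ⟨fun h => ⟨h, cyclesInside_subset h.2⟩, fun h => h.1⟩
    _ = ∑ v ∈ sinks D U, ((gradedPerms D (U.erase v)).card : ℝ) := by
        refine Finset.sum_congr rfl fun v hv => ?_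
        have hcard : ∀ e : Equiv.Perm α,
            v ∉ cyclesInside ((sinks D U).erase v) e := fun e h =>
          (Finset.mem_erase.1 (cyclesInside_subset h)).1 rfl
        calc _ = ∑ x ∈ (gradedPerms D (U.erase v)).sigma
                (fun e => insert v (cyclesInside ((sinks D U).erase v) e)),
                (1 / (((cyclesInside ((sinks D U).erase v) x.1).card : ℝ) + 1)) := by
              -- Cutting out `v` while recording its image `w = e v` is reversible. A permutation of
              -- the smaller set arises from as many `w` as its cycles inside `(sinks D U).erase v`
              -- have elements, plus one for `w = v`; the weights then add up to 1.
              refine Finset.sum_bij'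
                (i := fun e _ => (⟨Equiv.swap v (e v) * e, e v⟩ : Σ _ : Equiv.Perm α, α))
                (j := fun x _ => Equiv.swap v x.2 * x.1) ?_ ?_ ?_ ?_ ?_
              · intro e he
                rw [Finset.mem_filter] at he
                rw [Finset.mem_sigma]
                refine ⟨swap_mul_mem_gradedPerms_erase he.1 (mem_sinks.1 hv).1, ?_⟩
                rw [cyclesInside_erase he.2, Finset.insert_erase he.2]
                exact apply_mem_cyclesInside he.2
              · rintro ⟨e, w⟩ hx
                rw [Finset.mem_sigma] at hx
                have hev : e v = v := (mem_gradedPerms.1 hx.1).1 v (by simp)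
                rw [Finset.mem_filter]
                exact ⟨swap_mul_mem_gradedPerms hx.1 hv hx.2,
                  mem_cyclesInside_swap_mul hev hv hx.2⟩
              · intro e he
                simp [← mul_assoc]
              · rintro ⟨e, w⟩ hx
                rw [Finset.mem_sigma] at hx
                have hev : e v = v := (mem_gradedPerms.1 hx.1).1 v (by simp)
                simp [hev, ← mul_assoc]
              · intro e he
                rw [Finset.mem_filter] at he
                rw [cyclesInside_erase he.2, ← Finset.card_erase_add_one he.2]
                push_cast
                rfl
          _ = _ := by
              rw [Finset.sum_sigma, Finset.cast_card]
              refine Finset.sum_congr rfl fun e he => ?_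
              simp only [Finset.sum_const, Finset.card_insert_of_notMem (hcard e), nsmul_eq_mul]
              push_cast
              field_simp

end Counting

end StableAllocation

/-! ### Summation over all preference lists -/

namespace StableAllocation

variable {n : ℕ}

/-- The weights outside `U` are left arbitrary for the induction: when `v` is deleted, the condition
that `v` is a sink is absorbed into the weight of its list. -/
theorem sum_card_gradedPerms_mul_prod (f G : ℕ → ℝ)
    (hG : ∀ U : Finset (Fin n), ∀ v ∈ U, (∑ q : Equiv.Perm (Fin n),
      if ∀ i ∈ U, ¬ q.symm i < q.symm v then f ((q.symm v : ℕ) + 1) else 0) = G U.card)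
    (U : Finset (Fin n)) (ψ : Fin n → Equiv.Perm (Fin n) → ℝ)
    (hψ : ∀ k ∈ U, ∀ q : Equiv.Perm (Fin n), ψ k q = f ((q.symm k : ℕ) + 1)) :
    ∑ p : Preferences n, ((gradedPerms (Envies p) U).card : ℝ) * ∏ k, ψ k (p k) =
      (∏ k ∈ Uᶜ, ∑ q, ψ k q) * ∏ m ∈ Finset.Icc 1 U.card, ((m : ℝ) * G m) := by
  classical
  induction hc : U.card generalizing U ψ with
  | zero =>
    obtain rfl := Finset.card_eq_zero.1 hc
    simp only [gradedPerms_empty, Finset.card_singleton, Nat.cast_one, one_mul,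
      Finset.compl_empty]
    rw [Finset.prod_univ_sum, Fintype.piFinset_univ]
    simp
  | succ c ih =>
    have hU : U.Nonempty := Finset.card_pos.1 (by omega)
    let ψ' : Fin n → Fin n → Equiv.Perm (Fin n) → ℝ := fun v => Function.update ψ v fun q =>
      if ∀ i ∈ U, ¬ q.symm i < q.symm v then ψ v q else 0
    have hprod : ∀ (v : Fin n) (p : Preferences n),
        (∏ k, ψ' v k (p k)) =
          if ∀ i ∈ U, ¬ Envies p v i then ∏ k, ψ k (p k) else 0 := by
      intro v p
      rw [← Finset.mul_prod_erase Finset.univ _ (Finset.mem_univ v),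
        ← Finset.mul_prod_erase Finset.univ (fun k => ψ k (p k)) (Finset.mem_univ v)]
      have : ∏ k ∈ Finset.univ.erase v, ψ' v k (p k) =
          ∏ k ∈ Finset.univ.erase v, ψ k (p k) :=
        Finset.prod_congr rfl fun k hk => by
          simp only [ψ', Function.update_of_ne (Finset.ne_of_mem_erase hk)]
      rw [this]
      simp only [ψ', Function.update_self, ite_mul, zero_mul]
      by_cases h : ∀ i ∈ U, ¬ Envies p v i
      · exact (if_pos h).trans (if_pos h).symm
      · exact (if_neg h).trans (if_neg h).symm
    calc ∑ p : Preferences n, ((gradedPerms (Envies p) U).card : ℝ) * ∏ k, ψ k (p k)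
        = ∑ p : Preferences n, ∑ v ∈ U,
            ((gradedPerms (Envies p) (U.erase v)).card : ℝ) * ∏ k, ψ' v k (p k) := by
          refine Finset.sum_congr rfl fun p _ => ?_
          rw [card_gradedPerms _ hU, Finset.sum_mul, sinks, Finset.sum_filter]
          refine Finset.sum_congr rfl fun v _ => ?_
          rw [hprod]
          split_ifs <;> simp
      _ = ∑ v ∈ U, (∏ k ∈ (U.erase v)ᶜ, ∑ q, ψ' v k q) *
            ∏ m ∈ Finset.Icc 1 c, ((m : ℝ) * G m) := by
          rw [Finset.sum_comm]
          refine Finset.sum_congr rfl fun v hv => ih (U.erase v) (ψ' v) ?_ ?_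
          · intro k hk q
            simp only [ψ', Function.update_of_ne (Finset.ne_of_mem_erase hk)]
            exact hψ k (Finset.mem_of_mem_erase hk) q
          · rw [Finset.card_erase_of_mem hv, hc]; rfl
      _ = ∑ v ∈ U, (G (c + 1) * ∏ k ∈ Uᶜ, ∑ q, ψ k q) *
            ∏ m ∈ Finset.Icc 1 c, ((m : ℝ) * G m) := by
          refine Finset.sum_congr rfl fun v hv => ?_
          rw [Finset.compl_erase, Finset.prod_insert (by simpa using hv)]
          congr 2
          · rw [← hc, ← hG U v hv]
            refine Finset.sum_congr rfl fun q _ => ?_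
            simp only [ψ', Function.update_self, hψ v hv]
          · refine Finset.prod_congr rfl fun k hk => ?_
            have : k ≠ v := fun h => (Finset.mem_compl.1 hk) (h ▸ hv)
            simp only [ψ', Function.update_of_ne this]
      _ = _ := by
          rw [Finset.sum_const, hc, Finset.prod_Icc_succ_top (by omega), nsmul_eq_mul]
          ring

open Classical in
theorem sum_stable_prod (f G : ℕ → ℝ)
    (hG : ∀ U : Finset (Fin n), ∀ v ∈ U, (∑ q : Equiv.Perm (Fin n),
      if ∀ i ∈ U, ¬ q.symm i < q.symm v then f ((q.symm v : ℕ) + 1) else 0) = G U.card) :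
    ∑ p : Preferences n, ∑ g : Equiv.Perm (Fin n),
      (if IsStable p g then ∏ k, f (rank p k (g k)) else 0) =
      ∏ m ∈ Finset.Icc 1 n, ((m : ℝ) * G m) := by
  have h := sum_card_gradedPerms_mul_prod f G hG Finset.univ
    (fun k q => f ((q.symm k : ℕ) + 1)) (fun _ _ _ => rfl)
  rw [Finset.compl_univ, Finset.prod_empty, one_mul, Finset.card_univ, Fintype.card_fin] at h
  rw [← h, Finset.sum_comm]
  calc _ = ∑ g : Equiv.Perm (Fin n), ∑ p : Preferences n,
        (if IsGraded (Envies p) Finset.univ g then ∏ k, f (((p k).symm k : ℕ) + 1) else 0) := by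
        refine Finset.sum_congr rfl fun g _ => ?_
        -- For fixed `g`, relabelling the goods is a bijection of the preference systems.
        rw [← Equiv.sum_comp (Equiv.piCongrRight fun _ : Fin n => Equiv.mulLeft g)]
        refine Finset.sum_congr rfl fun p _ => ?_
        have : (Equiv.piCongrRight fun _ : Fin n => Equiv.mulLeft g) p = fun k => g * p k := rfl
        rw [this]
        simp only [isStable_mul_iff, rank_mul, Equiv.symm_apply_apply]
        rfl
    _ = _ := by
        rw [Finset.sum_comm]
        refine Finset.sum_congr rfl fun p _ => ?_
        rw [← Finset.sum_filter, Finset.sum_const, nsmul_eq_mul]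
        congr 3
        ext e
        simp [gradedPerms]

end StableAllocation

/-! ### Position of the first element of a set in a random permutation -/

namespace StableAllocation

section Minimum

variable {n : ℕ} {K : Finset (Fin n)} {v : Fin n}

theorem forall_mem_swap_iff {u w : Fin n} (hu : u ∈ K) (hw : w ∈ K) (P : Fin n → Prop) :
    (∀ i ∈ K, P (Equiv.swap u w i)) ↔ ∀ i ∈ K, P i := by
  have hmem : ∀ i, Equiv.swap u w i ∈ K ↔ i ∈ K := fun i =>
    iff_of_eq (apply_swap_of_eq (· ∈ K) (by simp only [hu, hw]) i)
  refine ⟨fun h i hi => ?_, fun h i hi => h _ ((hmem i).2 hi)⟩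
  simpa using h (Equiv.swap u w i) ((hmem i).2 hi)

/-- Each element of `K` is equally likely to come first, also with a symmetric weight. -/
theorem card_mul_sum_first (W : Equiv.Perm (Fin n) → ℝ)
    (hW : ∀ u ∈ K, ∀ v ∈ K, ∀ q, W (q * Equiv.swap u v) = W q) (hv : v ∈ K) :
    (K.card : ℝ) * ∑ q, (if ∀ i ∈ K, q v ≤ q i then W q else 0) = ∑ q, W q := by
  have hsymm : ∀ u ∈ K, ∑ q, (if ∀ i ∈ K, q u ≤ q i then W q else 0) =
      ∑ q, (if ∀ i ∈ K, q v ≤ q i then W q else 0) := by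
    intro u hu
    rw [← Equiv.sum_comp (Equiv.mulRight (Equiv.swap u v))]
    refine Finset.sum_congr rfl fun q _ => ?_
    simp only [Equiv.coe_mulRight, hW u hu v hv, Equiv.Perm.mul_apply, Equiv.swap_apply_left]
    exact if_congr (forall_mem_swap_iff hu hv fun i => q v ≤ q i) rfl rfl
  rw [← nsmul_eq_mul, ← Finset.sum_const, ← Finset.sum_congr rfl hsymm, Finset.sum_comm]
  refine Finset.sum_congr rfl fun q _ => ?_
  obtain ⟨u, hu, hmin⟩ := K.exists_min_image q ⟨v, hv⟩
  rw [Finset.sum_eq_single_of_mem u hu, if_pos hmin]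
  intro w hw hwu
  exact if_neg fun h => hwu (q.injective ((h u hu).antisymm (hmin w hw)))

theorem sum_first (hv : v ∈ K) :
    ∑ q : Equiv.Perm (Fin n), (if ∀ i ∈ K, q v ≤ q i then (1 : ℝ) else 0) =
      n.factorial / K.card := by
  have h := card_mul_sum_first (K := K) (fun _ => 1) (fun _ _ _ _ _ => rfl) hv
  have : (K.card : ℝ) ≠ 0 := by
    exact_mod_cast (Finset.card_pos.2 ⟨v, hv⟩).ne'
  rw [eq_div_iff this, mul_comm, h]
  simp [Fintype.card_perm]

/-- The event says that `a` is first in `insert a K` and `v` is first in `K`. The former is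
symmetric in `K`, so it serves as the weight in `card_mul_sum_first`. -/
theorem sum_second {a : Fin n} (hv : v ∈ K) (ha : a ∉ K) :
    ∑ q : Equiv.Perm (Fin n), (if (∀ i ∈ K, q v ≤ q i) ∧ q a < q v then (1 : ℝ) else 0) =
      n.factorial / (K.card * (K.card + 1)) := by
  have h := card_mul_sum_first (K := K)
    (fun q => if ∀ i ∈ insert a K, q a ≤ q i then (1 : ℝ) else 0) ?_ hv
  · have h0 : (K.card : ℝ) ≠ 0 := by exact_mod_cast (Finset.card_pos.2 ⟨v, hv⟩).ne'
    rw [sum_first (Finset.mem_insert_self a K), Finset.card_insert_of_notMem ha] at h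
    push_cast at h
    rw [mul_comm, ← eq_div_iff h0, div_div, mul_comm ((K.card : ℝ) + 1)] at h
    rw [← h]
    refine Finset.sum_congr rfl fun q _ => ?_
    rw [ite_and]
    refine if_ctx_congr Iff.rfl (fun hmin => if_congr ?_ rfl rfl) (fun _ => rfl)
    refine ⟨fun hav i hi => ?_, fun hall => ?_⟩
    · rcases Finset.mem_insert.1 hi with rfl | hi
      · exact le_rfl
      · exact hav.le.trans (hmin i hi)
    · exact (hall v (Finset.mem_insert_of_mem hv)).lt_of_ne
        fun he => ha (q.injective he ▸ hv)
  · intro u hu w hw q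
    have hau : a ≠ u := fun h => ha (h ▸ hu)
    have haw : a ≠ w := fun h => ha (h ▸ hw)
    simp only [Equiv.Perm.mul_apply, Finset.forall_mem_insert,
      Equiv.swap_apply_of_ne_of_ne hau haw]
    refine if_congr (and_congr_right fun _ => ?_) rfl rfl
    exact forall_mem_swap_iff hu hw fun i => q a ≤ q i

/-- The argument of `sum_second` once more, with the event of that lemma for `insert b K` as
symmetric weight. -/
theorem sum_third {a b : Fin n} (hv : v ∈ K) (ha : a ∉ K) (hb : b ∉ K) (hab : a ≠ b) :
    ∑ q : Equiv.Perm (Fin n),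
      (if (∀ i ∈ K, q v ≤ q i) ∧ q b < q v ∧ q a < q b then (1 : ℝ) else 0) =
      n.factorial / (K.card * (K.card + 1) * (K.card + 2)) := by
  have h := card_mul_sum_first (K := K)
    (fun q => if (∀ i ∈ insert b K, q b ≤ q i) ∧ q a < q b then (1 : ℝ) else 0) ?_ hv
  · have h0 : (K.card : ℝ) ≠ 0 := by exact_mod_cast (Finset.card_pos.2 ⟨v, hv⟩).ne'
    rw [sum_second (Finset.mem_insert_self b K) (by simp [hab, ha]),
      Finset.card_insert_of_notMem hb] at h
    push_cast at h
    rw [mul_comm, ← eq_div_iff h0, div_div] at h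
    rw [show (K.card : ℝ) * (K.card + 1) * (K.card + 2) =
      (K.card + 1) * (K.card + 1 + 1) * K.card by ring, ← h]
    refine Finset.sum_congr rfl fun q _ => ?_
    rw [ite_and]
    refine if_ctx_congr Iff.rfl (fun hmin => if_congr (and_congr_left' ?_) rfl rfl)
      (fun _ => rfl)
    refine ⟨fun hbv i hi => ?_, fun hall => ?_⟩
    · rcases Finset.mem_insert.1 hi with rfl | hi
      · exact le_rfl
      · exact hbv.le.trans (hmin i hi)
    · exact (hall v (Finset.mem_insert_of_mem hv)).lt_of_ne
        fun he => hb (q.injective he ▸ hv)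
  · intro u hu w hw q
    have hau : a ≠ u := fun h => ha (h ▸ hu)
    have haw : a ≠ w := fun h => ha (h ▸ hw)
    have hbu : b ≠ u := fun h => hb (h ▸ hu)
    have hbw : b ≠ w := fun h => hb (h ▸ hw)
    simp only [Equiv.Perm.mul_apply, Finset.forall_mem_insert,
      Equiv.swap_apply_of_ne_of_ne hau haw, Equiv.swap_apply_of_ne_of_ne hbu hbw]
    refine if_congr (and_congr_left fun _ => and_congr_right fun _ => ?_) rfl rfl
    exact forall_mem_swap_iff hu hw fun i => q b ≤ q i

theorem val_eq_sum (q : Equiv.Perm (Fin n)) (v : Fin n) :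
    ((q v : ℕ) : ℝ) = ∑ a, if q a < q v then (1 : ℝ) else 0 := by
  rw [Equiv.sum_comp q fun x => if x < q v then (1 : ℝ) else 0]
  rw [Finset.sum_boole, ← Fin.card_Iio]
  congr 2
  ext x
  simp

theorem val_mul_eq_sum (q : Equiv.Perm (Fin n)) (v : Fin n) :
    ((q v : ℕ) : ℝ) * ((q v : ℕ) - 1) / 2 =
      ∑ b, ∑ a, if q b < q v ∧ q a < q b then (1 : ℝ) else 0 := by
  have hgauss : ∀ N : ℕ, ∑ i ∈ Finset.range N, (i : ℝ) = (N : ℝ) * (N - 1) / 2 := by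
    intro N
    induction N with
    | zero => simp
    | succ N ih => rw [Finset.sum_range_succ, ih]; push_cast; ring
  have h1 : ∀ b, (∑ a, if q b < q v ∧ q a < q b then (1 : ℝ) else 0) =
      if q b < q v then ((q b : ℕ) : ℝ) else 0 := by
    intro b
    split_ifs with h
    · simp only [h, true_and, ← val_eq_sum]
    · simp [h]
  simp only [h1]
  rw [Equiv.sum_comp q fun x => if x < q v then ((x : ℕ) : ℝ) else 0, ← hgauss]
  have h2 := Fin.sum_univ_eq_sum_range (fun i => if i < (q v : ℕ) then (i : ℝ) else 0) n
  simp only [Fin.val_fin_lt] at h2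
  rw [h2, ← Finset.sum_filter]
  refine Finset.sum_congr ?_ fun _ _ => rfl
  ext i
  have := (q v).2
  simp only [Finset.mem_range, Finset.mem_filter]
  omega

/-- In the basis 1, `s`, `s * (s - 1) / 2`, the position `s` counts the elements before `v`, and the
last function counts the pairs of them. When `v` is first in `K`, all of these lie outside `K`,
which leaves `n - K.card` elements and the corresponding pairs. -/
theorem sum_first_quadratic (c₀ c₁ c₂ : ℝ) (hv : v ∈ K) :
    ∑ q : Equiv.Perm (Fin n), (if ∀ i ∈ K, q v ≤ q i then
        c₀ + c₁ * (q v : ℕ) + c₂ * ((q v : ℕ) * ((q v : ℕ) - 1) / 2) else 0) =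
      n.factorial / K.card * (c₀ + c₁ * ((n - K.card) / (K.card + 1)) +
        c₂ * ((n - K.card) * (n - K.card - 1) / ((K.card + 1) * (K.card + 2)))) := by
  classical
  have h0 : (K.card : ℝ) ≠ 0 := by exact_mod_cast (Finset.card_pos.2 ⟨v, hv⟩).ne'
  have hKn : K.card ≤ n := by simpa using Finset.card_le_univ K
  have hcompl : ((Kᶜ).card : ℝ) = n - K.card := by
    rw [Finset.card_compl, Fintype.card_fin, Nat.cast_sub hKn]
  have e1 : ∑ q : Equiv.Perm (Fin n), (if ∀ i ∈ K, q v ≤ q i then ((q v : ℕ) : ℝ) else 0) =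
      (n - K.card) * (n.factorial / (K.card * (K.card + 1))) := by
    have : ∀ q : Equiv.Perm (Fin n), (if ∀ i ∈ K, q v ≤ q i then ((q v : ℕ) : ℝ) else 0) =
        ∑ a, if (∀ i ∈ K, q v ≤ q i) ∧ q a < q v then (1 : ℝ) else 0 := by
      intro q
      split_ifs with h
      · rw [val_eq_sum]
        exact Finset.sum_congr rfl fun a _ => if_congr (and_iff_right h).symm rfl rfl
      · simp [h]
    simp only [this]
    rw [Finset.sum_comm, ← hcompl, ← nsmul_eq_mul, ← Finset.sum_const]
    symm
    apply Finset.sum_subset_zero_on_sdiff (Finset.subset_univ _)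
    · intro a ha
      refine Finset.sum_eq_zero fun q _ => if_neg ?_
      rintro ⟨h1, h2⟩
      exact absurd (h1 a (by simpa using ha)) h2.not_ge
    · intro a ha
      exact (sum_second hv (Finset.mem_compl.1 ha)).symm
  have e2 : ∑ q : Equiv.Perm (Fin n), (if ∀ i ∈ K, q v ≤ q i then
        ((q v : ℕ) : ℝ) * ((q v : ℕ) - 1) / 2 else 0) =
      (n - K.card) * ((n - K.card - 1) *
        (n.factorial / (K.card * (K.card + 1) * (K.card + 2)))) := by
    have : ∀ q : Equiv.Perm (Fin n), (if ∀ i ∈ K, q v ≤ q i then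
        ((q v : ℕ) : ℝ) * ((q v : ℕ) - 1) / 2 else 0) =
        ∑ b, ∑ a, if (∀ i ∈ K, q v ≤ q i) ∧ q b < q v ∧ q a < q b then (1 : ℝ) else 0 := by
      intro q
      split_ifs with h
      · rw [val_mul_eq_sum]
        exact Finset.sum_congr rfl fun b _ => Finset.sum_congr rfl fun a _ =>
          if_congr (and_iff_right h).symm rfl rfl
      · simp [h]
    simp only [this]
    rw [Finset.sum_comm, ← hcompl, ← nsmul_eq_mul, ← Finset.sum_const]
    symm
    apply Finset.sum_subset_zero_on_sdiff (Finset.subset_univ _)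
    · intro b hb
      refine Finset.sum_eq_zero fun q _ => Finset.sum_eq_zero fun a _ => if_neg ?_
      rintro ⟨h1, h2, -⟩
      exact absurd (h1 b (by simpa using hb)) h2.not_ge
    · intro b hb
      rw [Finset.sum_comm]
      have hcard : (((Kᶜ).erase b).card : ℝ) = ((Kᶜ).card : ℝ) - 1 := by
        rw [Finset.card_erase_of_mem hb, Nat.cast_sub (Finset.card_pos.2 ⟨b, hb⟩), Nat.cast_one]
      rw [← hcard, ← nsmul_eq_mul, ← Finset.sum_const]
      apply Finset.sum_subset_zero_on_sdiff (Finset.subset_univ _)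
      · intro a ha
        refine Finset.sum_eq_zero fun q _ => if_neg ?_
        rintro ⟨h1, h2, h3⟩
        have hacase : a = b ∨ a ∈ K := by
          simp only [Finset.mem_sdiff, Finset.mem_univ, Finset.mem_erase, Finset.mem_compl,
            true_and] at ha
          tauto
        rcases hacase with rfl | haK
        · exact lt_irrefl _ h3
        · exact absurd (h1 a haK) (h3.trans h2).not_ge
      · intro a ha
        rw [Finset.mem_erase, Finset.mem_compl] at ha
        exact (sum_third hv ha.2 (Finset.mem_compl.1 hb) ha.1).symm
  have hsplit : ∀ q : Equiv.Perm (Fin n), (if ∀ i ∈ K, q v ≤ q i then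
        c₀ + c₁ * (q v : ℕ) + c₂ * ((q v : ℕ) * ((q v : ℕ) - 1) / 2) else 0) =
      c₀ * (if ∀ i ∈ K, q v ≤ q i then (1 : ℝ) else 0) +
      c₁ * (if ∀ i ∈ K, q v ≤ q i then ((q v : ℕ) : ℝ) else 0) +
      c₂ * (if ∀ i ∈ K, q v ≤ q i then ((q v : ℕ) : ℝ) * ((q v : ℕ) - 1) / 2 else 0) := by
    intro q
    split_ifs <;> ring
  simp only [hsplit, Finset.sum_add_distrib, ← Finset.mul_sum, e1, e2, sum_first hv]
  field_simp

end Minimum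

end StableAllocation

/-! ### Quadratic weights, existence, Stirling numbers -/

namespace StableAllocation

variable {n : ℕ}

open Classical in
theorem sum_stable_prod_quadratic (f : ℕ → ℝ) (c₀ c₁ c₂ : ℝ)
    (hf : ∀ s : ℕ, f (s + 1) = c₀ + c₁ * s + c₂ * (s * (s - 1) / 2)) :
    ∑ p : Preferences n, ∑ g : Equiv.Perm (Fin n),
      (if IsStable p g then ∏ k, f (rank p k (g k)) else 0) =
      (n.factorial : ℝ) ^ n * ∏ m ∈ Finset.Icc 1 n, (c₀ + c₁ * ((n - m) / (m + 1)) +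
        c₂ * ((n - m) * (n - m - 1) / ((m + 1) * (m + 2)))) := by
  rw [sum_stable_prod f fun m => n.factorial / m * (c₀ + c₁ * ((n - m) / (m + 1)) +
        c₂ * ((n - m) * (n - m - 1) / ((m + 1) * (m + 2))))]
  · rw [Finset.prod_congr rfl (g := fun m : ℕ => (n.factorial : ℝ) *
      (c₀ + c₁ * ((n - m) / (m + 1)) + c₂ * ((n - m) * (n - m - 1) / ((m + 1) * (m + 2)))))]
    · rw [Finset.prod_mul_distrib, Finset.prod_const, Nat.card_Icc, Nat.add_sub_cancel]
    · intro m hm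
      have : (m : ℝ) ≠ 0 := by
        have := (Finset.mem_Icc.1 hm).1
        positivity
      rw [← mul_assoc, mul_div_cancel₀ _ this]
  · intro U v hv
    -- Inversion passes from lists (position to good) to positions (good to position).
    rw [← sum_first_quadratic c₀ c₁ c₂ hv, ← Equiv.sum_comp (Equiv.inv (Equiv.Perm (Fin n)))]
    refine Finset.sum_congr rfl fun q _ => ?_
    have : (Equiv.inv (Equiv.Perm (Fin n)) q).symm = q := rfl
    simp only [this, hf, not_lt]

/-- By uniqueness each preference system has at most one stable allocation, and with `f = 1` their
total equals the number of systems; so each has exactly one. -/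
theorem existsUnique_isStable (p : Preferences n) : ∃! g : Equiv.Perm (Fin n), IsStable p g := by
  classical
  suffices h : ∃ g, IsStable p g from h.imp fun g hg => ⟨hg, fun g' hg' => hg'.unique hg⟩
  have hsum := sum_stable_prod_quadratic (n := n) (fun _ => 1) 1 0 0 (fun s => by ring)
  have hle : ∀ p ∈ (Finset.univ : Finset (Preferences n)), ∑ g : Equiv.Perm (Fin n),
      (if IsStable p g then ∏ _k : Fin n, (1 : ℝ) else 0) ≤ 1 := by
    intro p _
    by_cases h : ∃ g, IsStable p g
    · obtain ⟨g, hg⟩ := h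
      rw [Finset.sum_eq_single g (fun g' _ hne => if_neg fun h => hne (h.unique hg)) (by simp)]
      simp [hg]
    · rw [Finset.sum_eq_zero fun g _ => if_neg fun hg => h ⟨g, hg⟩]
      exact zero_le_one
  have heq := (Finset.sum_eq_sum_iff_of_le hle).1 (hsum.trans (by simp [Fintype.card_perm]))
    p (Finset.mem_univ p)
  by_contra h
  rw [Finset.sum_eq_zero fun g _ => if_neg fun hg => h ⟨g, hg⟩] at heq
  exact zero_ne_one heq

theorem isStable_stableAllocation (p : Preferences n) : IsStable p (stableAllocation p) :=
  Classical.epsilon_spec (existsUnique_isStable p).exists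

theorem sum_prod_stableRank (f : ℕ → ℝ) (c₀ c₁ c₂ : ℝ)
    (hf : ∀ s : ℕ, f (s + 1) = c₀ + c₁ * s + c₂ * (s * (s - 1) / 2)) :
    ∑ p : Preferences n, ∏ k, f (stableRank p k) =
      (n.factorial : ℝ) ^ n * ∏ m ∈ Finset.Icc 1 n, (c₀ + c₁ * ((n - m) / (m + 1)) +
        c₂ * ((n - m) * (n - m - 1) / ((m + 1) * (m + 2)))) := by
  classical
  rw [← sum_stable_prod_quadratic f c₀ c₁ c₂ hf]
  refine Finset.sum_congr rfl fun p _ => ?_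
  rw [Finset.sum_eq_single (stableAllocation p)
    (fun g' _ hne => if_neg fun h => hne (h.unique (isStable_stableAllocation p))) (by simp),
    if_pos (isStable_stableAllocation p)]
  rfl

/-- The product of `m z + y` over `m = 1, …, N` in terms of Stirling cycle numbers. -/
theorem prod_mul_add_eq_sum_stirlingFirst (z y : ℝ) (N : ℕ) :
    ∏ m ∈ Finset.Icc 1 N, ((m : ℝ) * z + y) =
      ∑ k ∈ Finset.range (N + 1), (Nat.stirlingFirst (N + 1) (k + 1) : ℝ) * y ^ k *
        z ^ (N - k) := by
  induction N with
  | zero => simp [Nat.stirlingFirst]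
  | succ N ih =>
    rw [Finset.prod_Icc_succ_top (by omega), ih, mul_add, Finset.sum_mul, Finset.sum_mul]
    have hz : ∀ k ∈ Finset.range (N + 2), (Nat.stirlingFirst (N + 2) (k + 1) : ℝ) * y ^ k *
        z ^ (N + 1 - k) = ((N + 1 : ℕ) : ℝ) * (Nat.stirlingFirst (N + 1) (k + 1) : ℝ) * y ^ k *
          z ^ (N + 1 - k) + (Nat.stirlingFirst (N + 1) k : ℝ) * y ^ k * z ^ (N + 1 - k) := by
      intro k _
      rw [Nat.stirlingFirst_succ_succ]
      push_cast
      ring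
    rw [Finset.sum_congr rfl hz, Finset.sum_add_distrib]
    congr 1
    -- The top term vanishes here, and the term `k = 0` in the other sum, so both ranges shrink to
    -- that of the induction hypothesis.
    · rw [Finset.sum_range_succ _ (N + 1),
        Nat.stirlingFirst_eq_zero_of_lt (show N + 1 < N + 1 + 1 by omega)]
      simp only [Nat.cast_zero, mul_zero, zero_mul, add_zero]
      refine Finset.sum_congr rfl fun k hk => ?_
      have : N + 1 - k = N - k + 1 := by
        have := Finset.mem_range.1 hk
        omega
      rw [this, pow_succ]
      ring
    · rw [Finset.sum_range_succ' _ (N + 1)]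
      simp only [Nat.stirlingFirst_succ_zero, Nat.cast_zero, zero_mul, add_zero]
      refine Finset.sum_congr rfl fun k _ => ?_
      rw [show N + 1 - (k + 1) = N - k by omega, pow_succ]
      ring

/-! ### Expectations as averages over all preference systems -/

section Probability

open ProbabilityTheory

instance (n : ℕ) : MeasurableSingletonClass (Equiv.Perm (Fin n)) := ⟨fun _ => trivial⟩

variable {Ω : Type*} [MeasurableSpace Ω] {μ : Measure Ω} {P : Ω → Preferences n}

theorem IsUniformRandom.measurable_pi (hP : IsUniformRandom μ P) : Measurable P :=
  measurable_pi_lambda _ hP.measurable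

variable [IsProbabilityMeasure μ]

theorem IsUniformRandom.integrable (hP : IsUniformRandom μ P) (F : Preferences n → ℝ) :
    Integrable (fun ω => F (P ω)) μ := by
  have : IsProbabilityMeasure (μ.map P) :=
    Measure.isProbabilityMeasure_map hP.measurable_pi.aemeasurable
  exact (Integrable.of_finite (f := F) (μ := μ.map P)).comp_measurable hP.measurable_pi

theorem IsUniformRandom.integral_eq (hP : IsUniformRandom μ P) (F : Preferences n → ℝ) :
    ∫ ω, F (P ω) ∂μ = ((n.factorial : ℝ) ^ n)⁻¹ * ∑ p, F p := by
  have hprob : IsProbabilityMeasure (μ.map P) :=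
    Measure.isProbabilityMeasure_map hP.measurable_pi.aemeasurable
  have hmap : μ.map P = Measure.pi fun _ => uniformOn Set.univ := by
    have := (iIndepFun_iff_map_fun_eq_pi_map (fun k => (hP.measurable k).aemeasurable)).1 hP.indep
    simp only [hP.uniform] at this
    exact this
  have hsingle : ∀ p : Preferences n, (μ.map P).real {p} = ((n.factorial : ℝ) ^ n)⁻¹ := by
    intro p
    rw [hmap, measureReal_def, Measure.pi_singleton, ENNReal.toReal_prod]
    simp [uniformOn_univ, Fintype.card_perm]
  rw [← integral_map hP.measurable_pi.aemeasurable
    (Integrable.of_finite (f := F) (μ := μ.map P)).aestronglyMeasurable,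
    integral_fintype Integrable.of_finite, Finset.mul_sum]
  exact Finset.sum_congr rfl fun p _ => by rw [hsingle, smul_eq_mul]

end Probability

end StableAllocation

/-! ### Closed forms and coefficients -/

namespace StableAllocation

theorem prod_Icc_two_div_factorial (b : ℕ → ℝ) (N : ℕ) :
    ∏ m ∈ Finset.Icc 1 N, (b (m + 1) / ((m : ℝ) + 1)) =
      1 / ((N + 1).factorial : ℝ) * ∏ k ∈ Finset.Icc 2 (N + 1), b k := by
  induction N with
  | zero => simp
  | succ N ih =>
    rw [Finset.prod_Icc_succ_top (by omega), ih,
      Finset.prod_Icc_succ_top (show 2 ≤ N + 1 + 1 by omega),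
      Nat.factorial_succ (N + 1)]
    have := Nat.cast_ne_zero (R := ℝ).2 (Nat.factorial_ne_zero (N + 1))
    push_cast
    field_simp

theorem prod_rank_moment (n : ℕ) (z : ℝ) :
    ∏ m ∈ Finset.Icc 1 n, (z + 1 + 1 * (((n : ℝ) - m) / (m + 1)) +
        0 * ((n - m) * (n - m - 1) / ((m + 1) * (m + 2)))) =
      1 / ((n + 1).factorial : ℝ) * ∏ k ∈ Finset.Icc 2 (n + 1), ((k : ℝ) * z + n + 1) := by
  rw [← prod_Icc_two_div_factorial]
  refine Finset.prod_congr rfl fun m _ => ?_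
  have : (m : ℝ) + 1 ≠ 0 := by positivity
  push_cast
  field_simp
  ring

theorem prod_rank_sq_moment (n : ℕ) (z : ℝ) :
    ∏ m ∈ Finset.Icc 1 n, (z + 1 + 3 * (((n : ℝ) - m) / (m + 1)) +
        2 * ((n - m) * (n - m - 1) / ((m + 1) * (m + 2)))) =
      ∏ k ∈ Finset.Icc 1 n, (z + ((n : ℝ) + 1) * ((n : ℝ) + 1 + k) /
              (((n : ℝ) + 2 - k) * ((n : ℝ) + 3 - k))) := by
  -- The product is read backwards: the set size `m` corresponds to `k = n + 1 - m`.
  refine Finset.prod_nbij' (n + 1 - ·) (n + 1 - ·) ?_ ?_ ?_ ?_ ?_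
  · intro m hm
    simp only [Finset.mem_Icc] at hm ⊢
    omega
  · intro m hm
    simp only [Finset.mem_Icc] at hm ⊢
    omega
  · intro m hm
    simp only [Finset.mem_Icc] at hm
    omega
  · intro m hm
    simp only [Finset.mem_Icc] at hm
    omega
  · intro m hm
    have hm' : m ≤ n + 1 := by
      simp only [Finset.mem_Icc] at hm
      omega
    rw [Nat.cast_sub hm']
    have h1 : (m : ℝ) + 1 ≠ 0 := by positivity
    have h2 : (m : ℝ) + 2 ≠ 0 := by positivity
    push_cast
    rw [show (n : ℝ) + 2 - (n + 1 - m) = m + 1 by ring,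
      show (n : ℝ) + 3 - (n + 1 - m) = m + 2 by ring]
    field_simp
    ring

/-- The factor `z + n + 1` is the missing factor `k = 1`, which completes the product to the
generating function of the cycle numbers. -/
theorem prod_rank_moment_mul (n : ℕ) (z : ℝ) :
    1 / ((n + 1).factorial : ℝ) * (∏ k ∈ Finset.Icc 2 (n + 1), ((k : ℝ) * z + n + 1)) *
        (z + n + 1) =
      ∑ k ∈ Finset.range (n + 2), (Nat.stirlingFirst (n + 2) (k + 1) : ℝ) *
        (((n : ℝ) + 1) ^ k / ((n + 1).factorial : ℝ)) * z ^ (n + 1 - k) := by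
  have hIcc : Finset.Icc 1 (n + 1) = insert 1 (Finset.Icc 2 (n + 1)) := by
    ext k
    simp only [Finset.mem_insert, Finset.mem_Icc]
    omega
  have h := prod_mul_add_eq_sum_stirlingFirst z ((n : ℝ) + 1) (n + 1)
  rw [hIcc, Finset.prod_insert (by simp)] at h
  simp only [← add_assoc, Nat.cast_one, one_mul] at h
  rw [mul_assoc, mul_comm (∏ k ∈ Finset.Icc 2 (n + 1), _), h, Finset.mul_sum]
  exact Finset.sum_congr rfl fun k _ => by ring

/-- Division by `X + a`: the coefficients of the quotient, read from the top. -/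
theorem coeff_eq_of_mul_X_add_C {R : Type*} [CommRing R] {n : ℕ} {a : R} {s : ℕ → R}
    {Q : Polynomial R} (hdeg : Q.natDegree ≤ n)
    (hQ : ∀ j ≤ n, ((Polynomial.X + Polynomial.C a) * Q).coeff (n + 1 - j) = s j)
    {j : ℕ} (hj : j ≤ n) :
    Q.coeff (n - j) = ∑ i ∈ Finset.range (j + 1), (-a) ^ (j - i) * s i := by
  have hrec : ∀ j ≤ n, Q.coeff (n - j) = s j - a * Q.coeff (n - j + 1) := by
    intro j hj
    have h := hQ j hj
    rw [show n + 1 - j = n - j + 1 by omega, add_mul, Polynomial.coeff_add,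
      Polynomial.coeff_X_mul, Polynomial.coeff_C_mul] at h
    rw [← h, add_sub_cancel_right]
  induction j with
  | zero =>
    rw [hrec 0 hj, Polynomial.coeff_eq_zero_of_natDegree_lt (by omega)]
    simp
  | succ j ih =>
    rw [hrec _ hj, show n - (j + 1) + 1 = n - j by omega, ih (by omega),
      Finset.sum_range_succ _ (j + 1), Finset.mul_sum, sub_eq_neg_add, ← Finset.sum_neg_distrib]
    congr 1
    · refine Finset.sum_congr rfl fun i hi => ?_
      rw [Nat.succ_sub (Nat.lt_succ_iff.1 (Finset.mem_range.1 hi)), pow_succ]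
      ring
    · simp

end StableAllocation

theorem mainTheorem4 (n : ℕ) {Ω : Type*} [MeasurableSpace Ω] (μ : Measure Ω)
    [IsProbabilityMeasure μ] (P : Ω → Preferences n) (hP : IsUniformRandom μ P) :
    -- the stable allocation exists and is unique, whatever the preference lists are
    (∀ p : Preferences n, ∃! g : Equiv.Perm (Fin n), IsStable p g) ∧
      (∀ z : ℝ,
        -- the expectation of the product of the `z + r_k`
        (Integrable (fun ω => ∏ k, (z + (stableRank (P ω) k : ℝ))) μ ∧
          ∫ ω, ∏ k, (z + (stableRank (P ω) k : ℝ)) ∂μ =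
            1 / ((n + 1).factorial : ℝ) * ∏ k ∈ Finset.Icc 2 (n + 1), ((k : ℝ) * z + n + 1)) ∧
        -- its product with `z + n + 1`, in terms of Stirling cycle numbers
        ((∫ ω, ∏ k, (z + (stableRank (P ω) k : ℝ)) ∂μ) * (z + n + 1) =
          ∑ k ∈ Finset.range (n + 2), (Nat.stirlingFirst (n + 2) (k + 1) : ℝ) *
            (((n : ℝ) + 1) ^ k / ((n + 1).factorial : ℝ)) * z ^ (n + 1 - k)) ∧
        -- the expectation of the product of the `z + r_k ^ 2`
        (Integrable (fun ω => ∏ k, (z + (stableRank (P ω) k : ℝ) ^ 2)) μ ∧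
          ∫ ω, ∏ k, (z + (stableRank (P ω) k : ℝ) ^ 2) ∂μ =
            ∏ k ∈ Finset.Icc 1 n, (z + ((n : ℝ) + 1) * ((n : ℝ) + 1 + k) /
              (((n : ℝ) + 2 - k) * ((n : ℝ) + 3 - k)))) ) ∧
      -- the coefficient of `z ^ (n - j)` in the expectation of the product of the `z + r_k`
      (∀ j ≤ n,
        Integrable (fun ω =>
          (∏ k, (Polynomial.X + Polynomial.C (stableRank (P ω) k : ℝ))).coeff (n - j)) μ ∧
        ∫ ω, (∏ k, (Polynomial.X + Polynomial.C (stableRank (P ω) k : ℝ))).coeff (n - j) ∂μ =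
          ∑ i ∈ Finset.range (j + 1), (-((n : ℝ) + 1)) ^ (j - i) *
            ((Nat.stirlingFirst (n + 2) (i + 1) : ℝ) *
              (((n : ℝ) + 1) ^ i / ((n + 1).factorial : ℝ)))) := by
  have hfirst : ∀ z : ℝ, ((n.factorial : ℝ) ^ n)⁻¹ *
      ∑ p : Preferences n, ∏ k, (z + (stableRank p k : ℝ)) =
      1 / ((n + 1).factorial : ℝ) * ∏ k ∈ Finset.Icc 2 (n + 1), ((k : ℝ) * z + n + 1) := by
    intro z
    rw [sum_prod_stableRank (fun r => z + r) (z + 1) 1 0 (fun s => by push_cast; ring),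
      inv_mul_cancel_left₀ (by positivity), prod_rank_moment]
  refine ⟨existsUnique_isStable, fun z => ⟨⟨hP.integrable fun p => ∏ k, (z + (stableRank p k : ℝ)),
    ?_⟩, ?_, hP.integrable fun p => ∏ k, (z + (stableRank p k : ℝ) ^ 2), ?_⟩, fun j hj =>
    ⟨hP.integrable fun p =>
      (∏ k, (Polynomial.X + Polynomial.C (stableRank p k : ℝ))).coeff (n - j), ?_⟩⟩
  · rw [hP.integral_eq fun p => ∏ k, (z + (stableRank p k : ℝ)), hfirst]
  · rw [hP.integral_eq fun p => ∏ k, (z + (stableRank p k : ℝ)), hfirst, prod_rank_moment_mul]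
  · rw [hP.integral_eq fun p => ∏ k, (z + (stableRank p k : ℝ) ^ 2),
      -- The coefficients come from `(s + 1) ^ 2 = 1 + 3 * s + 2 * (s * (s - 1) / 2)`.
      sum_prod_stableRank (fun r => z + (r : ℝ) ^ 2) (z + 1) 3 2 (fun s => by push_cast; ring),
      inv_mul_cancel_left₀ (by positivity), prod_rank_sq_moment]
  · refine (hP.integral_eq fun p =>
      (∏ k, (Polynomial.X + Polynomial.C (stableRank p k : ℝ))).coeff (n - j)).trans ?_
    let Q : Polynomial ℝ := Polynomial.C ((n.factorial : ℝ) ^ n)⁻¹ *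
      ∑ p : Preferences n, ∏ k, (Polynomial.X + Polynomial.C (stableRank p k : ℝ))
    have hmul : (Polynomial.X + Polynomial.C ((n : ℝ) + 1)) * Q =
        ∑ k ∈ Finset.range (n + 2), Polynomial.C ((Nat.stirlingFirst (n + 2) (k + 1) : ℝ) *
          (((n : ℝ) + 1) ^ k / ((n + 1).factorial : ℝ))) * Polynomial.X ^ (n + 1 - k) := by
      -- The identity already known at every real `z` is one of polynomials, so the coefficients of
      -- `Q` follow by dividing by the linear factor.
      refine Polynomial.funext fun z => ?_
      have h := prod_rank_moment_mul n z
      rw [← hfirst z] at h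
      simp only [Q, Polynomial.eval_mul, Polynomial.eval_add, Polynomial.eval_X,
        Polynomial.eval_C, Polynomial.eval_finsetSum, Polynomial.eval_prod, Polynomial.eval_pow]
      rw [← h]
      ring
    have hdeg : Q.natDegree ≤ n := by
      refine (Polynomial.natDegree_C_mul_le _ _).trans
        (Polynomial.natDegree_sum_le_of_forall_le _ _ fun p _ => ?_)
      refine (Polynomial.natDegree_prod_le _ _).trans ?_
      simp only [Polynomial.natDegree_X_add_C, Finset.sum_const, Finset.card_univ,
        Fintype.card_fin, smul_eq_mul, mul_one, le_refl]
    have hQ := coeff_eq_of_mul_X_add_C (Q := Q) (a := (n : ℝ) + 1)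
      (s := fun i => (Nat.stirlingFirst (n + 2) (i + 1) : ℝ) *
        (((n : ℝ) + 1) ^ i / ((n + 1).factorial : ℝ))) hdeg ?_ hj
    · rw [← hQ, Polynomial.coeff_C_mul, Polynomial.finsetSum_coeff]
    · intro i hi
      rw [hmul, Polynomial.finsetSum_coeff,
        Finset.sum_eq_single_of_mem i (Finset.mem_range.2 (by omega))]
      · rw [Polynomial.coeff_C_mul_X_pow, if_pos rfl]
      · intro k hk hki
        rw [Polynomial.coeff_C_mul_X_pow, if_neg]
        have := Finset.mem_range.1 hk
        omega
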